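/- Let $\gamma$ be a regular dodecagon in the plane (a closed convex polygon). For a point $p$ outside $\gamma$, draw the tangent ray from $p$ to $\gamma$ that is the right one as seen from $p$, so that $\gamma$ lies to the left of it. If this ray meets $\gamma$ in exactly one point $q$, let $T(p)=2q-p$ be the reflection of $p$ in $q$; otherwise (when the ray contains a side of $\gamma$) $T(p)$ is undefined. The partial map $T$, called the outer billiard map outside $\gamma$, is injective where it is defined, so $T^{n}(p)$ makes sense, when it is defined, for every $n\in\mathbb Z$. A point $p$ outside $\gamma$ is called periodic if $T^n(p)$ is defined and equal to $p$ for some integer $n\ge 1$, and aperiodic if it is not periodic and its orbit is infinite in both directions, i.e. $T^n(p)$ is defined for all $n\in\mathbb Z$. Theorem. For every regular dodecagon $\gamma$ there exists an aperiodic point of the outer billiard map outside $\gamma$. -/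

import Mathlib

namespace OuterBilliard

/-- The oriented area `u × v` of the parallelogram spanned by two vectors of the plane `ℂ = ℝ²`. -/
def cross (u v : ℂ) : ℝ := u.re * v.im - u.im * v.re

/-- The right tangent from the point `p` outside the table `K` touches `K` at the single point `q`:
seen from `p`, all the other points of `K` lie strictly to the left of the ray from `p` through `q`. -/
def IsRightTangencyPoint (K : Set ℂ) (p q : ℂ) : Prop :=
  p ∉ K ∧ q ∈ K ∧ ∀ x ∈ K, x ≠ q → 0 < cross (q - p) (x - p)

/-- The tangency point is unique, so the value of the map `T` below does not depend on a choice. -/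
theorem IsRightTangencyPoint.unique {K : Set ℂ} {p q₁ q₂ : ℂ}
    (h₁ : IsRightTangencyPoint K p q₁) (h₂ : IsRightTangencyPoint K p q₂) : q₁ = q₂ := by
  by_contra hne
  have a := h₁.2.2 q₂ h₂.2.1 (Ne.symm hne)
  have b := h₂.2.2 q₁ h₁.2.1 hne
  simp only [cross] at a b
  linarith

/-- The outer billiard map `T` of the table `K`, as a partial map of the plane: `T p` is defined
when `p` lies outside `K` and the right tangent from `p` meets `K` in exactly one point `q`, and then
`T p` is the reflection `2 q - p` of `p` in `q`. -/
noncomputable def T (K : Set ℂ) : ℂ →. ℂ := fun p =>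
  ⟨∃ q, IsRightTangencyPoint K p q, fun h => 2 * h.choose - p⟩

theorem mem_T_iff {K : Set ℂ} {p p' : ℂ} :
    p' ∈ T K p ↔ ∃ q, IsRightTangencyPoint K p q ∧ p' = 2 * q - p := by
  constructor
  · rintro ⟨h, rfl⟩
    exact ⟨h.choose, h.choose_spec, rfl⟩
  · rintro ⟨q, hq, rfl⟩
    have h : ∃ q, IsRightTangencyPoint K p q := ⟨q, hq⟩
    refine ⟨h, ?_⟩
    change 2 * h.choose - p = 2 * q - p
    rw [h.choose_spec.unique hq]

/-- `T` is injective on its domain, so a point has at most one preimage `T⁻¹ p` and at most one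
two-sided orbit. -/
theorem T_injective {K : Set ℂ} {p₁ p₂ p' : ℂ} (h₁ : p' ∈ T K p₁) (h₂ : p' ∈ T K p₂) :
    p₁ = p₂ := by
  obtain ⟨q₁, t₁, e₁⟩ := mem_T_iff.1 h₁
  obtain ⟨q₂, t₂, e₂⟩ := mem_T_iff.1 h₂
  have e₁' : p₁ = 2 * q₁ - p' := by rw [e₁]; ring
  have e₂' : p₂ = 2 * q₂ - p' := by rw [e₂]; ring
  by_cases hq : q₁ = q₂
  · rw [e₁', e₂', hq]
  · exfalso
    have a := t₁.2.2 q₂ t₂.2.1 (Ne.symm hq)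
    have b := t₂.2.2 q₁ t₁.2.1 hq
    rw [e₁'] at a
    rw [e₂'] at b
    simp [cross] at a b
    nlinarith

/-- The iterates `T ^ n` of the partial map `T`, for `n ≥ 0`. -/
noncomputable def iter (K : Set ℂ) : ℕ → ℂ →. ℂ
  | 0 => fun p => Part.some p
  | n + 1 => fun p => (iter K n p).bind (T K)

/-- `p` lies outside `K` and `T ^ n p` is defined and equal to `p` for some `n ≥ 1`. -/
def IsPeriodicPoint (K : Set ℂ) (p : ℂ) : Prop :=
  p ∉ K ∧ ∃ n : ℕ, 1 ≤ n ∧ p ∈ iter K n p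

/-- The orbit of `p` is infinite in both directions: `T ^ n p` is defined for all integers `n`. In
the sequence below `u n` is `T ^ n p`. -/
def HasTwoSidedOrbit (K : Set ℂ) (p : ℂ) : Prop :=
  ∃ u : ℤ → ℂ, u 0 = p ∧ ∀ n : ℤ, u (n + 1) ∈ T K (u n)

/-- `p` lies outside `K`, is not periodic, and has an orbit that is infinite in both directions. -/
def IsAperiodicPoint (K : Set ℂ) (p : ℂ) : Prop :=
  p ∉ K ∧ ¬ IsPeriodicPoint K p ∧ HasTwoSidedOrbit K p

/-- The closed convex regular `n`-gon with centre `c` and vertices `c + w * exp (2 π i k / n)`,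
`k = 0, …, n - 1`. For `n ≥ 3`, as `c` runs over `ℂ` and `w` over `ℂ \ {0}`, these are all the
regular `n`-gons of the plane. -/
noncomputable def regularPolygon (n : ℕ) (c w : ℂ) : Set ℂ :=
  convexHull ℝ (Set.range fun k : Fin n =>
    c + w * Complex.exp (2 * (Real.pi : ℂ) * Complex.I * ((k : ℕ) : ℂ) / (n : ℂ)))

end OuterBilliard

namespace OuterBilliard.Dodecagon

/-! ### Exact arithmetic in `ℤ[√3]` and `ℤ[ζ]`, `ζ = exp (2πi/12)` -/

/-! After a rotation, a point whose tangency vertex is known is described by the vector `d` from it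
to that vertex, lying in a fixed open cone with apex 0. Modulo the rotations of the dodecagon, the
billiard map then acts by isometries `d ↦ 1 - ζ⁻ʲ (1 + d)` on polygonal pieces of this cone.

The dynamics near the apex is self-similar with ratio `7 - 4√3`. Eight cells carry isometries that
are iterates of the cone map, and each such isometry, conjugated by the homothety, is again an
iterate of the cell map on the shrunk cell. So orbit segments can be shrunk arbitrarily often
(`transGen_ratio_pow_mul`). Moreover, one shrunk cell passes strictly inside its own cell. The
resulting contraction has a fixed point `p` there, so `ratio * p` leads to `p`; with `q` the next
point after `p` under the cell map, `q` leads to `ratio * q` (`exists_recurrent_point`).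

Shrinking these segments gives a two-sided orbit … → `ratio * p` → `p` → `q` → `ratio * q` → …. Its
past visits all the distinct points `ratio ^ n * p`, up to rotation, so it is not periodic
(`isAperiodicPoint_of_transGen`).

Whole polygons are followed exactly, by integer arithmetic. Disjointness and completeness of the
cells, and minimality of the return times, are never needed. -/

/-- The number `a + b √3`. -/
structure Surd where
  a : ℤ
  b : ℤ

namespace Surd

noncomputable def val (x : Surd) : ℝ := x.a + x.b * √3

def add (x y : Surd) : Surd := ⟨x.a + y.a, x.b + y.b⟩

/-- Multiplication by the integer `n`. -/
def smul (n : ℤ) (x : Surd) : Surd := ⟨n * x.a, n * x.b⟩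

/-- Multiplication by `7 - 4 √3`. -/
def shrink (x : Surd) : Surd := ⟨7 * x.a - 12 * x.b, 7 * x.b - 4 * x.a⟩

def le (x y : Surd) : Bool :=
  let a := y.a - x.a
  let b := y.b - x.b
  (decide (0 ≤ a) && (decide (0 ≤ b) || decide (3 * (b * b) ≤ a * a))) ||
    (decide (0 ≤ b) && decide (a * a ≤ 3 * (b * b)))

def lt (x y : Surd) : Bool := x.le y && !(y.le x)

@[simp] theorem val_add (x y : Surd) : (x.add y).val = x.val + y.val := by
  simp only [val, add]; push_cast; ring

@[simp] theorem val_smul (n : ℤ) (x : Surd) : (x.smul n).val = n * x.val := by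
  simp only [val, smul]; push_cast; ring

@[simp] theorem val_shrink (x : Surd) : x.shrink.val = (7 - 4 * √3) * x.val := by
  have h : √3 * √3 = 3 := Real.mul_self_sqrt (by norm_num)
  simp only [val, shrink]; push_cast; linear_combination 4 * (x.b : ℝ) * h

/-- When `a` and `b` have opposite signs, the conjugate `a - b√3` has a known sign, so the norm `a²
- 3b²` decides. This makes all comparisons integer tests. -/
theorem nonneg_iff (a b : ℤ) : (0 : ℝ) ≤ a + b * √3 ↔
    (0 ≤ a ∧ (0 ≤ b ∨ 3 * (b * b) ≤ a * a)) ∨ (0 ≤ b ∧ a * a ≤ 3 * (b * b)) := by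
  have h : √3 * √3 = 3 := Real.mul_self_sqrt (by norm_num)
  have h0 : 0 < √3 := Real.sqrt_pos.2 (by norm_num)
  have key : (a : ℝ) * a - 3 * (b * b) = (a + b * √3) * (a - b * √3) := by
    linear_combination (b : ℝ) * b * h
  rcases le_or_gt 0 a with ha | ha <;> rcases le_or_gt 0 b with hb | hb
  · have ha' : (0 : ℝ) ≤ a := by exact_mod_cast ha
    have hb' : (0 : ℝ) ≤ b := by exact_mod_cast hb
    simp only [ha, hb, true_and, true_or, iff_true]
    positivity
  · have ha' : (0 : ℝ) ≤ a := by exact_mod_cast ha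
    have hb' : (b : ℝ) < 0 := by exact_mod_cast hb
    have hs : 0 < (a : ℝ) - b * √3 := by nlinarith
    simp only [ha, hb.not_ge, true_and, false_and, false_or, or_false]
    rw [← @Int.cast_le ℝ]
    push_cast
    rw [← sub_nonneg (b := 3 * ((b : ℝ) * b)), key, mul_nonneg_iff_of_pos_right hs]
  · have ha' : (a : ℝ) < 0 := by exact_mod_cast ha
    have hb' : (0 : ℝ) ≤ b := by exact_mod_cast hb
    have hs : 0 < (b : ℝ) * √3 - a := by nlinarith [mul_nonneg hb' h0.le]
    simp only [hb, ha.not_ge, true_and, false_and, false_or]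
    rw [← @Int.cast_le ℝ]
    push_cast
    rw [← sub_nonneg (b := (a : ℝ) * a),
      show 3 * ((b : ℝ) * b) - a * a = (a + b * √3) * (b * √3 - a) by linear_combination -key,
      mul_nonneg_iff_of_pos_right hs]
  · have ha' : (a : ℝ) < 0 := by exact_mod_cast ha
    have hb' : (b : ℝ) < 0 := by exact_mod_cast hb
    simp only [ha.not_ge, hb.not_ge, false_and, or_self, iff_false, not_le]
    nlinarith

theorem le_iff (x y : Surd) : x.le y = true ↔ x.val ≤ y.val := by
  have := nonneg_iff (y.a - x.a) (y.b - x.b)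
  rw [← sub_nonneg, show y.val - x.val = ((y.a - x.a : ℤ) : ℝ) + ((y.b - x.b : ℤ) : ℝ) * √3 by
    simp only [val]; push_cast; ring, this]
  simp [le]

theorem lt_iff (x y : Surd) : x.lt y = true ↔ x.val < y.val := by
  have h1 := le_iff x y
  have h2 := le_iff y x
  rw [lt, Bool.and_eq_true, h1, Bool.not_eq_true', ← Bool.not_eq_true, h2, not_le]
  exact ⟨fun h => h.2, fun h => ⟨h.le, h⟩⟩

end Surd

/-- The ratio of the self-similarity of the dynamics. -/
noncomputable def ratio : ℝ := 7 - 4 * √3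

theorem ratio_pos : 0 < ratio := by
  have h : √3 * √3 = 3 := Real.mul_self_sqrt (by norm_num)
  unfold ratio; nlinarith [Real.sqrt_nonneg 3]

theorem ratio_lt_one : ratio < 1 := by
  have h : √3 * √3 = 3 := Real.mul_self_sqrt (by norm_num)
  unfold ratio; nlinarith [Real.sqrt_nonneg 3]

/-- The primitive twelfth root of unity `exp (2πi/12)`. -/
noncomputable def zeta : ℂ := ⟨√3 / 2, 1 / 2⟩

theorem zeta_eq_exp : zeta = Complex.exp (2 * Real.pi * Complex.I / 12) := by
  rw [show (2 * Real.pi * Complex.I / 12 : ℂ) = ((Real.pi / 6 : ℝ) : ℂ) * Complex.I by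
    push_cast; ring]
  apply Complex.ext
  · rw [Complex.exp_ofReal_mul_I_re, Real.cos_pi_div_six, zeta]
  · rw [Complex.exp_ofReal_mul_I_im, Real.sin_pi_div_six, zeta]

theorem zeta_sq : zeta ^ 2 = ⟨1 / 2, √3 / 2⟩ := by
  have h : √3 * √3 = 3 := Real.mul_self_sqrt (by norm_num)
  rw [sq]
  apply Complex.ext <;> simp [zeta] <;> linarith

theorem zeta_pow_three : zeta ^ 3 = Complex.I := by
  have h : √3 * √3 = 3 := Real.mul_self_sqrt (by norm_num)
  rw [pow_succ, zeta_sq]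
  apply Complex.ext <;> simp [zeta] <;> linarith

theorem zeta_pow_four : zeta ^ 4 = zeta ^ 2 - 1 := by
  rw [pow_succ, zeta_pow_three, zeta_sq]
  apply Complex.ext <;> simp [zeta]; norm_num

theorem zeta_pow_six : zeta ^ 6 = -1 := by
  rw [show zeta ^ 6 = (zeta ^ 3) ^ 2 by ring, zeta_pow_three, Complex.I_sq]

theorem zeta_pow_twelve : zeta ^ 12 = 1 := by
  rw [show zeta ^ 12 = (zeta ^ 6) ^ 2 by ring, zeta_pow_six]; norm_num

theorem zeta_ne_zero : zeta ≠ 0 := by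
  intro h; have := zeta_pow_twelve; rw [h] at this; norm_num at this

theorem norm_zeta : ‖zeta‖ = 1 :=
  Complex.norm_eq_one_of_pow_eq_one zeta_pow_twelve (by norm_num)

theorem zeta_mul_conj : zeta * (starRingEnd ℂ) zeta = 1 := by
  rw [Complex.mul_conj, Complex.normSq_eq_norm_sq, norm_zeta]; norm_num

theorem zeta_pow_mod (n : ℕ) : zeta ^ (n % 12) = zeta ^ n :=
  (pow_eq_pow_mod n zeta_pow_twelve).symm

/-- Twice the inner product of `d` with `ζ ^ k + ζ ^ (k + 1)`: all the lines of discontinuity are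
level sets of these functionals. -/
noncomputable def level (k : ℕ) (d : ℂ) : ℝ :=
  2 * (d * (starRingEnd ℂ) (zeta ^ k + zeta ^ (k + 1))).re

theorem level_add (k : ℕ) (x y : ℂ) : level k (x + y) = level k x + level k y := by
  simp only [level, add_mul, Complex.add_re]; ring

theorem level_real_mul (k : ℕ) (t : ℝ) (x : ℂ) : level k (t * x) = t * level k x := by
  simp only [level, mul_assoc, Complex.re_ofReal_mul]; ring

theorem level_mod (k : ℕ) (x : ℂ) : level (k % 12) x = level k x := by
  simp only [level, pow_succ, zeta_pow_mod]

/-- Rotations permute the twelve functionals, so polygons with sides in these directions stay in the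
same class. -/
theorem level_rotate (k r : ℕ) (x : ℂ) : level (k + r) (zeta ^ r * x) = level k x := by
  have h : zeta ^ r * (starRingEnd ℂ) zeta ^ r = 1 := by
    rw [← mul_pow, zeta_mul_conj, one_pow]
  simp only [level, map_add, map_pow]
  congr 2
  rw [show k + r + 1 = (k + 1) + r by ring, pow_add, pow_add]
  linear_combination (x * ((starRingEnd ℂ) zeta ^ k + (starRingEnd ℂ) zeta ^ (k + 1))) * h

/-- The value of `level k` at `1`. -/
def levelOne (k : ℕ) : Surd :=
  match k % 12 with
  | 0 => ⟨2, 1⟩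
  | 1 => ⟨1, 1⟩
  | 2 => ⟨1, 0⟩
  | 3 => ⟨-1, 0⟩
  | 4 => ⟨-1, -1⟩
  | 5 => ⟨-2, -1⟩
  | 6 => ⟨-2, -1⟩
  | 7 => ⟨-1, -1⟩
  | 8 => ⟨-1, 0⟩
  | 9 => ⟨1, 0⟩
  | 10 => ⟨1, 1⟩
  | _ => ⟨2, 1⟩

theorem level_add_six (k : ℕ) (x : ℂ) : level (k + 6) x = -level k x := by
  rw [level, show zeta ^ (k + 6) + zeta ^ (k + 6 + 1) = zeta ^ 6 * (zeta ^ k + zeta ^ (k + 1)) by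
    ring, zeta_pow_six, level, neg_one_mul, map_neg, mul_neg, Complex.neg_re, mul_neg]

theorem val_levelOne (k : ℕ) : (levelOne k).val = level k 1 := by
  have h0 : level 0 1 = 2 + √3 := by simp [level, zeta]; ring
  have h1 : level 1 1 = 1 + √3 := by simp [level, zeta_sq]; simp [zeta]; ring
  have h2 : level 2 1 = 1 := by simp [level, zeta_sq, zeta_pow_three]
  have h3 : level 3 1 = -1 := by simp [level, zeta_pow_four, zeta_sq, zeta_pow_three]; norm_num
  have h4 : level 4 1 = -1 - √3 := by
    rw [level, show (zeta ^ 4 + zeta ^ (4 + 1)) = zeta ^ 4 * (1 + zeta) by ring, zeta_pow_four,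
      zeta_sq]
    have h : √3 * √3 = 3 := Real.mul_self_sqrt (by norm_num)
    simp [zeta]; linarith
  have h5 : level 5 1 = -2 - √3 := by
    rw [level, show (zeta ^ 5 + zeta ^ (5 + 1)) = zeta ^ 3 * zeta ^ 2 + zeta ^ 6 by ring,
      zeta_pow_six, zeta_sq, zeta_pow_three]
    simp; ring
  have h6 (k : ℕ) := level_add_six k 1
  rw [← level_mod, levelOne]
  have : k % 12 < 12 := Nat.mod_lt _ (by norm_num)
  have e6 := h6 0
  have e7 := h6 1
  have e8 := h6 2
  have e9 := h6 3
  have e10 := h6 4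
  have e11 := h6 5
  norm_num at e6 e7 e8 e9 e10 e11
  interval_cases k % 12 <;> simp [Surd.val, *] <;> ring

/-- The element `a + b ζ + c ζ² + d ζ³` of `ℤ[ζ]`. -/
structure Cyclo where
  a : ℤ
  b : ℤ
  c : ℤ
  d : ℤ
deriving DecidableEq

namespace Cyclo

noncomputable def val (x : Cyclo) : ℂ := x.a + x.b * zeta + x.c * zeta ^ 2 + x.d * zeta ^ 3

def add (x y : Cyclo) : Cyclo := ⟨x.a + y.a, x.b + y.b, x.c + y.c, x.d + y.d⟩

/-- Multiplication by `ζ ^ r`. -/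
def rotate : ℕ → Cyclo → Cyclo
  | 0, x => x
  | r + 1, x => rotate r ⟨-x.d, x.a, x.b + x.d, x.c⟩

/-- Multiplication by `7 - 4 √3`. -/
def shrink (x : Cyclo) : Cyclo :=
  ⟨7 * x.a - 4 * x.b + 4 * x.d, -8 * x.a + 7 * x.b - 4 * x.c,
    -4 * x.b + 7 * x.c - 8 * x.d, 4 * x.a - 4 * x.c + 7 * x.d⟩

/-- The value of `level k`. -/
def level (k : ℕ) (x : Cyclo) : Surd :=
  (((levelOne k).smul x.a).add ((levelOne (k + 11)).smul x.b)).add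
    (((levelOne (k + 10)).smul x.c).add ((levelOne (k + 9)).smul x.d))

@[simp] theorem val_add (x y : Cyclo) : (x.add y).val = x.val + y.val := by
  simp only [val, add]; push_cast; ring

@[simp] theorem val_rotate (r : ℕ) (x : Cyclo) : (rotate r x).val = zeta ^ r * x.val := by
  induction r generalizing x with
  | zero => simp [rotate]
  | succ r ih =>
    rw [rotate, ih, pow_succ, mul_assoc]
    congr 1
    simp only [val]
    push_cast
    linear_combination -(x.d : ℂ) * zeta_pow_four

@[simp] theorem val_shrink (x : Cyclo) : x.shrink.val = (ratio : ℂ) * x.val := by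
  -- This is `√3 = ζ + ζ⁻¹ = 2ζ - ζ³`.
  have h : (ratio : ℂ) = 7 - 8 * zeta + 4 * zeta ^ 3 := by
    rw [zeta_pow_three, ratio]
    apply Complex.ext <;> simp [zeta] <;> ring
  rw [h]
  simp only [val, shrink]
  push_cast
  linear_combination (8 * (x.d : ℂ) - 4 * x.b - 4 * x.c * zeta - 4 * x.d * (zeta ^ 2 + 1)) *
    zeta_pow_four

/-- By rotation, `level k (ζ ^ i) = level (k - i) 1`; the indices `k + 11`, `k + 10`, `k + 9` are `k
- 1`, `k - 2`, `k - 3` modulo 12. -/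
theorem val_level (k : ℕ) (x : Cyclo) : (x.level k).val = Dodecagon.level k x.val := by
  have e (j : ℕ) (n : ℤ) (i : ℕ) (hj : j + i = k + 12 ∨ j + i = k) :
      Dodecagon.level k (n * zeta ^ i) = n * Dodecagon.level j 1 := by
    have h : Dodecagon.level k (n * zeta ^ i) = Dodecagon.level (j + i) (n * zeta ^ i) := by
      rcases hj with hj | hj
      · rw [hj, ← level_mod (k + 12), Nat.add_mod_right, level_mod]
      · rw [hj]
    rw [h, mul_comm, level_rotate, ← level_real_mul, mul_one, Complex.ofReal_intCast]
  have e0 := e k x.a 0 (Or.inr rfl)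
  have e1 := e (k + 11) x.b 1 (Or.inl rfl)
  rw [pow_zero, mul_one] at e0
  rw [pow_one] at e1
  simp only [level, Surd.val_add, Surd.val_smul, val_levelOne, val, level_add, e0, e1,
    e (k + 10) x.c 2 (Or.inl rfl), e (k + 9) x.d 3 (Or.inl rfl)]
  ring

end Cyclo


/-! ### Verified tracking of polygons under piecewise isometries -/

/-- The isometry `d ↦ ζ ^ r d + b`. -/
structure Isom where
  r : ℕ
  b : Cyclo
deriving DecidableEq

/-- The open polygon given by the inequalities `6 * level k d < s`, for the listed pairs `(k, s)`. -/
abbrev Region := List (ℕ × Surd)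

/-- An isometry restricted to an open polygon. -/
structure Move where
  region : Region
  isom : Isom

/-- Evaluates `n` before `f` is applied to it. -/
def forceNat {α : Type} (n : ℕ) (f : ℕ → α) : α :=
  match n with
  | 0 => f 0
  | m + 1 => f (m + 1)

/-- Evaluates `n` before `f` is applied to it. -/
def forceInt {α : Type} (n : ℤ) (f : ℤ → α) : α :=
  match n with
  | .ofNat m => forceNat m fun m => f (.ofNat m)
  | .negSucc m => forceNat m fun m => f (.negSucc m)

@[simp] theorem forceNat_eq {α : Type} (n : ℕ) (f : ℕ → α) : forceNat n f = f n := by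
  cases n <;> rfl

@[simp] theorem forceInt_eq {α : Type} (n : ℤ) (f : ℤ → α) : forceInt n f = f n := by
  cases n <;> simp [forceInt]

namespace Isom

noncomputable def app (g : Isom) (x : ℂ) : ℂ := zeta ^ g.r * x + g.b.val

def one : Isom := ⟨0, ⟨0, 0, 0, 0⟩⟩

def comp (f g : Isom) : Isom := ⟨(f.r + g.r) % 12, (g.b.rotate f.r).add f.b⟩

/-- The conjugate of `g` by the homothety of ratio `7 - 4 √3`. -/
def shrink (g : Isom) : Isom := ⟨g.r, g.b.shrink⟩

/-- Evaluates the components of `g` before `f` is applied to it. -/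
def force {α : Type} (g : Isom) (f : Isom → α) : α :=
  forceNat g.r fun r => forceInt g.b.a fun a => forceInt g.b.b fun b => forceInt g.b.c fun c =>
    forceInt g.b.d fun d => f ⟨r, ⟨a, b, c, d⟩⟩

@[simp] theorem force_eq {α : Type} (g : Isom) (f : Isom → α) : g.force f = f g := by
  simp [force]

@[simp] theorem app_one (x : ℂ) : one.app x = x := by simp [app, one, Cyclo.val]

theorem app_comp (f g : Isom) (x : ℂ) : (f.comp g).app x = f.app (g.app x) := by
  simp only [app, comp, zeta_pow_mod, Cyclo.val_add, Cyclo.val_rotate, pow_add]; ring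

theorem app_shrink (g : Isom) (x : ℂ) : g.shrink.app (ratio * x) = ratio * g.app x := by
  simp only [app, shrink, Cyclo.val_shrink]; ring

theorem level_app (g : Isom) (k : ℕ) (x : ℂ) :
    level (k + g.r) (g.app x) = level k x + (g.b.level (k + g.r)).val := by
  rw [app, level_add, level_rotate, Cyclo.val_level]

end Isom

namespace Region

def points (Q : Region) : Set ℂ := {x | ∀ c ∈ Q, 6 * level c.1 x < c.2.val}

/-- The image under the homothety of ratio `7 - 4 √3`. -/
def shrink (Q : Region) : Region := Q.map fun c => (c.1, c.2.shrink)

theorem mem_points_shrink {Q : Region} {x : ℂ} (h : x ∈ Q.points) :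
    (ratio : ℂ) * x ∈ Q.shrink.points := by
  intro c hc
  obtain ⟨c, hc', rfl⟩ := List.mem_map.1 hc
  rw [Surd.val_shrink, level_real_mul, ← ratio]
  nlinarith [h c hc', ratio_pos]

/-- The bound for `6 * level k` on the image of `Q` under `g` that comes from a bound in the list
`Q`. -/
def imageBound (Q : Region) (g : Isom) (k : ℕ) : Option Surd :=
  (Q.lookup ((k + 12 - g.r) % 12)).map fun s => s.add ((g.b.level k).smul 6)

/-- A sufficient condition for `g` to map `Q` into `Q'`. -/
def mapsTo (Q : Region) (g : Isom) (Q' : Region) : Bool :=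
  Q'.all fun c => (Q.imageBound g c.1).any fun s => s.le c.2

/-- A sufficient condition for `g` to map the closure of `Q` into `Q'`. -/
def mapsClosureTo (Q : Region) (g : Isom) (Q' : Region) : Bool :=
  Q'.all fun c => (Q.imageBound g c.1).any fun s => s.lt c.2

theorem mem_of_lookup {Q : Region} {k : ℕ} {s : Surd} (h : Q.lookup k = some s) : (k, s) ∈ Q := by
  rw [List.lookup_eq_some_iff] at h
  obtain ⟨l₁, l₂, rfl, -⟩ := h
  simp

/-- An isometry carries a listed half-plane to a half-plane and preserves the signed slack. The
condition `g.r ≤ 12` keeps `k + 12 - g.r` from truncating. -/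
theorem exists_of_imageBound {Q : Region} {g : Isom} (hg : g.r ≤ 12) {k : ℕ} {s : Surd}
    (h : Q.imageBound g k = some s) :
    ∃ c ∈ Q, ∀ x, 6 * level k (g.app x) - s.val = 6 * level c.1 x - c.2.val := by
  obtain ⟨s', hs', rfl⟩ := Option.map_eq_some_iff.1 h
  refine ⟨_, mem_of_lookup hs', fun x => ?_⟩
  have hk : ((k + 12 - g.r) % 12 + g.r) % 12 = k % 12 := by omega
  have e (y : ℂ) : level ((k + 12 - g.r) % 12 + g.r) y = level k y := by
    rw [← level_mod, hk, level_mod]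
  have := g.level_app ((k + 12 - g.r) % 12) x
  rw [Cyclo.val_level, e, e, ← Cyclo.val_level] at this
  rw [this, Surd.val_add, Surd.val_smul]
  push_cast
  ring

theorem app_mem_of_mapsTo {Q Q' : Region} {g : Isom} (hg : g.r ≤ 12) (h : Q.mapsTo g Q' = true)
    {x : ℂ} (hx : x ∈ Q.points) : g.app x ∈ Q'.points := by
  intro c hc
  obtain ⟨s, hs, hle⟩ := (Option.any_eq_true _ _).1 (List.all_eq_true.1 h c hc)
  obtain ⟨c', hc', e⟩ := exists_of_imageBound hg hs
  rw [Surd.le_iff] at hle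
  linarith [hx c' hc', e x]

end Region

/-- One step of the piecewise isometry with the pieces `M`. -/
def Moves (M : List Move) (x y : ℂ) : Prop := ∃ m ∈ M, x ∈ m.region.points ∧ y = m.isom.app x

/-- Follows the polygon `Q`, moved by `g`, for `n` steps of the piecewise isometry with the pieces
`M`. -/
def follow (M : List Move) (Q : Region) : ℕ → Isom → Option Isom
  | 0, g => some g
  | n + 1, g => (M.find? fun m => Q.mapsTo g m.region).bind fun m =>
      (m.isom.comp g).force fun h => follow M Q n h

/-- At each step the whole image of `Q` lies in one piece, so all points of `Q` share an itinerary
and one composed isometry. -/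
theorem reflTransGen_of_follow {M : List Move} {Q : Region} {x : ℂ} (hx : x ∈ Q.points) {n : ℕ}
    {g h : Isom} (hg : g.r ≤ 12) (hf : follow M Q n g = some h) :
    Relation.ReflTransGen (Moves M) (g.app x) (h.app x) := by
  induction n generalizing g with
  | zero => cases hf; exact .refl
  | succ n ih =>
    obtain ⟨m, hm, hf⟩ := Option.bind_eq_some_iff.1 hf
    rw [Isom.force_eq] at hf
    refine .head ⟨m, List.mem_of_find?_eq_some hm, ?_, Isom.app_comp _ _ _⟩
      (ih (Nat.mod_lt _ (by norm_num)).le hf)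
    exact Region.app_mem_of_mapsTo hg (by simpa using List.find?_some hm) hx

theorem transGen_of_follow {M : List Move} {Q : Region} {x : ℂ} (hx : x ∈ Q.points) {n : ℕ}
    (hn : n ≠ 0) {g h : Isom} (hg : g.r ≤ 12) (hf : follow M Q n g = some h) :
    Relation.TransGen (Moves M) (g.app x) (h.app x) := by
  obtain ⟨n, rfl⟩ := Nat.exists_eq_succ_of_ne_zero hn
  obtain ⟨m, hm, hf⟩ := Option.bind_eq_some_iff.1 hf
  rw [Isom.force_eq] at hf
  refine .head' ⟨m, List.mem_of_find?_eq_some hm, ?_, Isom.app_comp _ _ _⟩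
    (reflTransGen_of_follow hx (Nat.mod_lt _ (by norm_num)).le hf)
  exact Region.app_mem_of_mapsTo hg (by simpa using List.find?_some hm) hx

open Classical in
/-- A contraction that maps the closure of a polygon into the polygon has a fixed point there. -/
theorem exists_fixed_point {Q : Region} {g : Isom} (hg : g.r ≤ 12)
    (h : Q.shrink.mapsClosureTo g Q = true) : ∃ x ∈ Q.points, g.app (ratio * x) = x := by
  have hne : (1 : ℂ) - zeta ^ g.r * ratio ≠ 0 := by
    intro h0
    have := congrArg norm (sub_eq_zero.1 h0)
    rw [norm_mul, norm_pow, norm_zeta, Complex.norm_real, Real.norm_of_nonneg ratio_pos.le] at this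
    norm_num at this
    exact ratio_lt_one.ne' this
  set p : ℂ := g.b.val / (1 - zeta ^ g.r * ratio) with hp
  have hfix : g.app (ratio * p) = p := by
    rw [Isom.app, hp]; field_simp; ring
  refine ⟨p, ?_, hfix⟩
  by_contra hmem
  have hQ : Q ≠ [] := by rintro rfl; exact hmem (by intro c hc; simp at hc)
  -- Let `M` be the largest violation of a bound at `p`. Since `p` is fixed and the inclusion is
  -- strict, `M < ratio * M`, hence `M < 0` and all bounds hold.
  obtain ⟨c, hc, hmax⟩ := Q.toFinset.exists_max_image (fun c => 6 * level c.1 p - c.2.val)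
    (List.toFinset_nonempty_iff Q |>.2 hQ)
  simp only [List.mem_toFinset] at hc hmax
  obtain ⟨s, hs, hlt⟩ := (Option.any_eq_true _ _).1 (List.all_eq_true.1 h c hc)
  obtain ⟨c', hc', e⟩ := Region.exists_of_imageBound hg hs
  obtain ⟨c', hc'', rfl⟩ := List.mem_map.1 hc'
  rw [Surd.lt_iff] at hlt
  have e := e (ratio * p)
  rw [hfix, level_real_mul, Surd.val_shrink, ← ratio] at e
  have h1 := hmax c' hc''
  apply hmem
  intro d hd
  have h2 := hmax d hd
  nlinarith [ratio_pos, ratio_lt_one]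

/-! ### The pieces -/

/-- A piece on which the step `d ↦ 1 - ζ⁻ʲ (1 + d)` stays in the cone at the vertex. -/
def coneMove (j : ℕ) : Move :=
  let g : Isom := ⟨(18 - j) % 12, (Cyclo.rotate (18 - j) ⟨1, 0, 0, 0⟩).add ⟨1, 0, 0, 0⟩⟩
  ⟨[(11, ⟨0, 0⟩), (6, ⟨0, 0⟩), ((23 - g.r) % 12, (g.b.level 11).smul (-6)),
    ((18 - g.r) % 12, (g.b.level 6).smul (-6))], g⟩

def coneMoves : List Move := [1, 2, 3, 4, 5].map coneMove

/-- A piece of the first return map to a neighbourhood of the vertex, with the number of steps to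
the first return of the piece, and the number of steps of the first return map that the
piece shrunk by `7 - 4 √3` needs to come back to the shrunk pieces. -/
structure Cell extends Move where
  steps : ℕ
  returns : ℕ

/-- Bounds in all twelve directions are listed, because `imageBound` looks up the rotated direction
and fails if it is absent. -/
def cell0 : Cell :=
  ⟨⟨[(0, ⟨0, 2⟩), (1, ⟨6, 0⟩), (2, ⟨0, 6⟩), (3, ⟨12, 0⟩), (4, ⟨0, 6⟩), (5, ⟨6, 0⟩), (6, ⟨0,
      0⟩), (7, ⟨0, 0⟩), (8, ⟨0, 0⟩), (9, ⟨0, 0⟩), (10, ⟨0, 0⟩), (11, ⟨0, 0⟩)],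
      ⟨5, ⟨1, -1, 0, 1⟩⟩⟩, 1, 8⟩

def cell1 : Cell :=
  ⟨⟨[(0, ⟨3, 3⟩), (1, ⟨9, 3⟩), (2, ⟨6, 6⟩), (3, ⟨12, 4⟩), (4, ⟨6, 6⟩), (5, ⟨6, 2⟩), (6, ⟨0,
      0⟩), (7, ⟨-6, 0⟩), (8, ⟨0, -4⟩), (9, ⟨-6, 0⟩), (10, ⟨0, -2⟩), (11, ⟨0, 0⟩)],
      ⟨4, ⟨0, 0, 1, 0⟩⟩⟩, 1, 8⟩

def cell2 : Cell :=
  ⟨⟨[(0, ⟨12, 0⟩), (1, ⟨9, 9⟩), (2, ⟨15, 9⟩), (3, ⟨18, 6⟩), (4, ⟨9, 9⟩), (5, ⟨9, 3⟩), (6, ⟨0,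
      0⟩), (7, ⟨-6, -2⟩), (8, ⟨-6, -6⟩), (9, ⟨-9, -3⟩), (10, ⟨-3, -3⟩), (11, ⟨0, 0⟩)],
      ⟨3, ⟨1, 0, 0, 1⟩⟩⟩, 1, 8⟩

def cell3 : Cell :=
  ⟨⟨[(0, ⟨6, 6⟩), (1, ⟨18, 6⟩), (2, ⟨12, 12⟩), (3, ⟨18, 6⟩), (4, ⟨3, 9⟩), (5, ⟨9, -3⟩), (6,
      ⟨-12, 0⟩), (7, ⟨-12, -6⟩), (8, ⟨-6, -12⟩), (9, ⟨-24, 0⟩), (10, ⟨6, -12⟩), (11, ⟨0, 0⟩)],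
      ⟨5, ⟨1, -1, 2, 1⟩⟩⟩, 2, 16⟩

def cell4 : Cell :=
  ⟨⟨[(0, ⟨-3, 9⟩), (1, ⟨27, -3⟩), (2, ⟨-6, 18⟩), (3, ⟨36, -8⟩), (4, ⟨-18, 18⟩), (5, ⟨18, -10⟩),
      (6, ⟨-12, 0⟩), (7, ⟨-42, 12⟩), (8, ⟨24, -28⟩), (9, ⟨-42, 12⟩), (10, ⟨12, -14⟩), (11, ⟨0,
      0⟩)],
      ⟨1, ⟨-5, 5, 2, -4⟩⟩⟩, 13, 106⟩

def cell5 : Cell :=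
  ⟨⟨[(0, ⟨-12, 14⟩), (1, ⟨42, -12⟩), (2, ⟨-48, 42⟩), (3, ⟨84, -36⟩), (4, ⟨-60, 42⟩), (5, ⟨42,
      -24⟩), (6, ⟨-12, 0⟩), (7, ⟨0, -12⟩), (8, ⟨-24, 0⟩), (9, ⟨0, -12⟩), (10, ⟨-12, 0⟩), (11,
      ⟨0, 0⟩)],
      ⟨2, ⟨-3, -2, 11, -8⟩⟩⟩, 28, 231⟩

def cell6 : Cell :=
  ⟨⟨[(0, ⟨-6, 12⟩), (1, ⟨36, -6⟩), (2, ⟨-12, 24⟩), (3, ⟨36, -6⟩), (4, ⟨-6, 12⟩), (5, ⟨12, -6⟩),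
      (6, ⟨-12, 0⟩), (7, ⟨-27, 3⟩), (8, ⟨21, -27⟩), (9, ⟨-54, 18⟩), (10, ⟨18, -18⟩), (11, ⟨0,
      0⟩)],
      ⟨11, ⟨-9, 5, 8, -9⟩⟩⟩, 30, 150⟩

def cell7 : Cell :=
  ⟨⟨[(0, ⟨-18, 18⟩), (1, ⟨54, -18⟩), (2, ⟨-36, 36⟩), (3, ⟨54, -18⟩), (4, ⟨-33, 27⟩), (5, ⟨27,
      -15⟩), (6, ⟨-12, 0⟩), (7, ⟨-18, -2⟩), (8, ⟨6, -18⟩), (9, ⟨-27, 3⟩), (10, ⟨3, -9⟩), (11,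
      ⟨0, 0⟩)],
      ⟨0, ⟨2, -6, 6, -2⟩⟩⟩, 56, 269⟩

/-- The pieces of the first return map to the part `level 3 d < 3 + √3` of the cone. -/
def cells : List Cell := [cell0, cell1, cell2, cell3, cell4, cell5, cell6, cell7]

def cellMoves : List Move := cells.map Cell.toMove

/-- The isometry of each cell is an iterate of the billiard map. -/
def isFirstReturn (c : Cell) : Bool :=
  c.steps != 0 && follow coneMoves c.region c.steps .one == some c.isom

/-- On the shrunk cell, the conjugate of the isometry of the cell is an iterate of the return map. -/
def isRenormalizable (c : Cell) : Bool :=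
  c.returns != 0 && follow cellMoves c.region.shrink c.returns .one == some c.isom.shrink

/-- The shrunk cell passes through the interior of the cell, and comes back later. -/
def isRecurrent (c : Cell) (n m : ℕ) : Bool :=
  m != 0 && n != 0 && (follow cellMoves c.region.shrink n .one).any fun g =>
    c.region.shrink.mapsClosureTo g c.region && decide (g.r ≤ 12) &&
      follow cellMoves c.region.shrink m (c.isom.comp g) == some c.isom.shrink

set_option maxRecDepth 100000 in
theorem cells_isFirstReturn : cells.all isFirstReturn = true := by decide +kernel

set_option maxRecDepth 100000 in
theorem cells_isRenormalizable : cells.all isRenormalizable = true := by decide +kernel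

-- The loop from the shrunk cell back to the shrunk cells takes `35 + 1 + 114 = 150` steps, the
-- `returns` of `cell6`; the middle step is `cell6` itself.
set_option maxRecDepth 100000 in
theorem cell6_isRecurrent : isRecurrent cell6 35 114 = true := by decide +kernel


open Relation

/-! ### The billiard map in the cone at a vertex -/

theorem cross_mul_left (a u v : ℂ) : cross (a * u) (a * v) = Complex.normSq a * cross u v := by
  simp only [cross, Complex.mul_re, Complex.mul_im, Complex.normSq_apply]; ring

/-- In the cone at the vertex `1`, the ray with direction `d` to this vertex has the other vertices
on its left. -/
theorem cross_zeta_pow_sub_one_pos {d : ℂ} (h₁ : level 11 d < 0) (h₂ : level 6 d < 0) {j : ℕ}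
    (hj : j % 12 ≠ 0) : 0 < cross d (zeta ^ j - 1) := by
  have h : √3 * √3 = 3 := Real.mul_self_sqrt (by norm_num)
  have h0 : 0 < √3 := Real.sqrt_pos.2 (by norm_num)
  have hs : √3 < 2 := by nlinarith
  have e5 : zeta ^ 5 = ⟨-(√3 / 2), 1 / 2⟩ := by
    rw [show zeta ^ 5 = zeta ^ 3 * zeta ^ 2 by ring, zeta_pow_three, zeta_sq]
    apply Complex.ext <;> simp
  have e4 : zeta ^ 4 = ⟨-1 / 2, √3 / 2⟩ := by
    rw [zeta_pow_four, zeta_sq]; apply Complex.ext <;> simp; norm_num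
  have six (i : ℕ) : zeta ^ (i + 6) = -zeta ^ i := by rw [pow_add, zeta_pow_six]; ring
  have e7 := six 1
  have e8 := six 2
  have e9 := six 3
  have e10 := six 4
  have e11 := six 5
  norm_num at e7 e8 e9 e10 e11
  rw [level_add_six 5, level, zeta_pow_six, e5] at h₁
  rw [level_add_six 0, level, pow_zero, zero_add, pow_one] at h₂
  simp [zeta] at h₁ h₂
  -- The argument of `d` lies strictly between 75° and 105°, and that of `ζ ^ j - 1` is `90° + 15°
  -- j` for `1 ≤ j ≤ 11`. The inequalities below compare `d` with the slopes of these chords.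
  have u : 0 < d.im - (2 + √3) * d.re := by linarith
  have v : 0 < d.im + (2 + √3) * d.re := by linarith
  have u'' : 0 < 2 * d.im - d.im * √3 - d.re := by nlinarith
  have v'' : 0 < 2 * d.im - d.im * √3 + d.re := by nlinarith
  have him : 0 < d.im := by linarith
  have him' : 0 < d.im * √3 := mul_pos him h0
  have hs1 : 0 < √3 - 1 := by nlinarith
  have hs2 : 0 < 2 * √3 - 3 := by nlinarith
  have a₁ : 0 < d.im - d.re := by nlinarith [mul_pos hs1 him, mul_pos (sub_pos.2 hs) u]
  have a₂ : 0 < d.im + d.re := by nlinarith [mul_pos hs1 him, mul_pos (sub_pos.2 hs) v]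
  have b₁ : 0 < d.im - √3 * d.re := by nlinarith [mul_pos (sub_pos.2 hs) him, mul_pos hs2 u]
  have b₂ : 0 < d.im + √3 * d.re := by nlinarith [mul_pos (sub_pos.2 hs) him, mul_pos hs2 v]
  rw [← zeta_pow_mod]
  have hlt : j % 12 < 12 := Nat.mod_lt _ (by norm_num)
  generalize j % 12 = i at *
  interval_cases i
  · exact absurd rfl hj
  all_goals
    simp [cross, zeta_sq, zeta_pow_three, *]
    try simp [zeta]
    linarith

/-- The point with the coordinate `d` in the cone at the `k`-th vertex. -/
noncomputable def point (c w : ℂ) (k : ℕ) (d : ℂ) : ℂ := c + w * (zeta ^ k * (1 - d))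

theorem regularPolygon_twelve (c w : ℂ) :
    regularPolygon 12 c w = convexHull ℝ (Set.range fun k : Fin 12 => c + w * zeta ^ (k : ℕ)) := by
  simp only [regularPolygon, zeta_eq_exp, ← Complex.exp_nat_mul]
  congr! 6
  push_cast
  ring_nf

/-- Adding one boundary point to an open half-plane keeps it convex. This carries strict leftness
from the vertices to their hull, except at the tangency vertex. -/
theorem convex_insert_cross_pos (q v : ℂ) : Convex ℝ {x | x = q ∨ 0 < cross v (x - q)} := by
  intro x hx y hy a b ha hb hab
  have e : a • x + b • y - q = a • (x - q) + b • (y - q) := by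
    have : (a : ℂ) + b = 1 := by exact_mod_cast hab
    simp only [Complex.real_smul]; linear_combination q * this
  have e' : cross v (a • x + b • y - q) = a * cross v (x - q) + b * cross v (y - q) := by
    rw [e]; simp [cross]; ring
  rcases hx with rfl | hx <;> rcases hy with rfl | hy
  · left; rw [← add_smul, hab, one_smul]
  · rcases hb.eq_or_lt with rfl | hb
    · left; simp [show a = 1 by linarith]
    · right; rw [e']; simp [cross] at hy ⊢; nlinarith
  · rcases ha.eq_or_lt with rfl | ha
    · left; simp [show b = 1 by linarith]
    · right; rw [e']; simp [cross] at hx ⊢; nlinarith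
  · right
    rw [e']
    rcases ha.eq_or_lt with rfl | ha
    · rw [show b = 1 by linarith]; linarith
    · nlinarith [mul_pos ha hx, mul_nonneg hb hy.le]

theorem isRightTangencyPoint_point {c w : ℂ} (hw : w ≠ 0) (k : ℕ) {d : ℂ} (h₁ : level 11 d < 0)
    (h₂ : level 6 d < 0) :
    IsRightTangencyPoint (regularPolygon 12 c w) (point c w k d) (c + w * zeta ^ k) := by
  have hq : c + w * zeta ^ k ∈ regularPolygon 12 c w := by
    rw [regularPolygon_twelve, ← zeta_pow_mod]
    exact subset_convexHull ℝ _ ⟨⟨k % 12, Nat.mod_lt _ (by norm_num)⟩, rfl⟩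
  have hd : c + w * zeta ^ k - point c w k d = w * zeta ^ k * d := by rw [point]; ring
  have hleft : ∀ x ∈ regularPolygon 12 c w, x ≠ c + w * zeta ^ k →
      0 < cross (c + w * zeta ^ k - point c w k d) (x - point c w k d) := by
    have hsub : regularPolygon 12 c w ⊆ {x | x = c + w * zeta ^ k ∨
        0 < cross (w * zeta ^ k * d) (x - (c + w * zeta ^ k))} := by
      rw [regularPolygon_twelve]
      refine convexHull_min ?_ (convex_insert_cross_pos _ _)
      rintro _ ⟨i, rfl⟩
      -- Here `i + 11 * k` stands for `i - k` modulo 12.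
      have hi : (k + (i + 11 * k)) % 12 = i := by have := i.2; omega
      have e : zeta ^ (i : ℕ) = zeta ^ k * zeta ^ (i + 11 * k) := by
        rw [← pow_add, ← zeta_pow_mod (k + _), hi]
      by_cases h0 : (i + 11 * k) % 12 = 0
      · left
        simp only [e]
        rw [← zeta_pow_mod (i + _), h0, pow_zero, mul_one]
      · right
        rw [show c + w * zeta ^ (i : ℕ) - (c + w * zeta ^ k) =
          w * zeta ^ k * (zeta ^ (i + 11 * k) - 1) by rw [e]; ring, cross_mul_left]
        exact mul_pos (Complex.normSq_pos.2 (mul_ne_zero hw (pow_ne_zero _ zeta_ne_zero)))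
          (cross_zeta_pow_sub_one_pos h₁ h₂ h0)
    intro x hx hne
    have := (hsub hx).resolve_left hne
    rw [← hd] at this
    simp only [cross, Complex.sub_re, Complex.sub_im] at this ⊢
    linarith
  refine ⟨fun hp => ?_, hq, hleft⟩
  -- If the point were in the table and not the vertex, `hleft` at the point itself would give `0 <
  -- 0`.
  have hne : point c w k d ≠ c + w * zeta ^ k := by
    intro h
    rw [h, sub_self, eq_comm, mul_eq_zero] at hd
    rw [hd.resolve_left (mul_ne_zero hw (pow_ne_zero _ zeta_ne_zero))] at h₁
    simp [level] at h₁
  have := hleft _ hp hne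
  simp [cross] at this

theorem point_add_twelve_mul (c w : ℂ) (k i : ℕ) (d : ℂ) :
    point c w (k + 12 * i) d = point c w k d := by
  rw [point, pow_add, pow_mul, zeta_pow_twelve, one_pow, mul_one, point]

theorem point_mod (c w : ℂ) (k : ℕ) (d : ℂ) : point c w (k % 12) d = point c w k d := by
  rw [point, zeta_pow_mod, point]

/-- The steps of the piecewise isometry of the cone are steps of the billiard map up to rotation. -/
theorem mem_T_of_moves {c w : ℂ} (hw : w ≠ 0) {d e : ℂ} (h : Moves coneMoves d e) :
    ∃ i, ∀ k, point c w (k + i) e ∈ T (regularPolygon 12 c w) (point c w k d) := by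
  obtain ⟨m, hm, hd, rfl⟩ := h
  obtain ⟨j, -, rfl⟩ := List.mem_map.1 hm
  have h₁ := hd (11, ⟨0, 0⟩) (by simp [coneMove])
  have h₂ := hd (6, ⟨0, 0⟩) (by simp [coneMove])
  simp only [Surd.val, Int.cast_zero, zero_mul, add_zero] at h₁ h₂
  -- This witness is congruent to `j` modulo 12: the tangency vertex advances by `j`.
  refine ⟨6 + 11 * (18 - j), fun k => mem_T_iff.2 ⟨_,
    isRightTangencyPoint_point hw k (d := d) (by linarith) (by linarith), ?_⟩⟩
  have e1 : zeta ^ (11 * (18 - j)) * zeta ^ (18 - j) = 1 := by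
    rw [← pow_add, show 11 * (18 - j) + (18 - j) = 12 * (18 - j) by ring, pow_mul,
      zeta_pow_twelve, one_pow]
  have e2 : Cyclo.val ⟨1, 0, 0, 0⟩ = 1 := by simp [Cyclo.val]
  simp only [point, Isom.app, coneMove, Cyclo.val_add, Cyclo.val_rotate, e2, zeta_pow_mod, pow_add,
    zeta_pow_six]
  linear_combination w * zeta ^ k * (1 + d) * e1

/-! ### Orbits -/

theorem exists_int_chain {α : Type*} {R : α → α → Prop} {S : Set α}
    (hf : ∀ x ∈ S, ∃ y ∈ S, R x y) (hb : ∀ y ∈ S, ∃ x ∈ S, R x y) {x : α} (hx : x ∈ S) :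
    ∃ u : ℤ → α, u 0 = x ∧ ∀ n, R (u n) (u (n + 1)) := by
  choose! f hfS hf using hf
  choose! g hgS hg using hb
  have hfn (n : ℕ) : f^[n] x ∈ S := by
    induction n with
    | zero => exact hx
    | succ n ih => rw [Function.iterate_succ_apply']; exact hfS _ ih
  have hgn (n : ℕ) : g^[n] x ∈ S := by
    induction n with
    | zero => exact hx
    | succ n ih => rw [Function.iterate_succ_apply']; exact hgS _ ih
  refine ⟨fun n => match n with
    | .ofNat n => f^[n] x
    | .negSucc n => g^[n + 1] x, rfl, ?_⟩
  rintro (n | n)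
  · change R (f^[n] x) (f^[n + 1] x)
    rw [Function.iterate_succ_apply']
    exact hf _ (hfn n)
  · rcases n with _ | n
    · exact hg _ hx
    · change R (g^[n + 1 + 1] x) (g^[n + 1] x)
      rw [Function.iterate_succ_apply']
      exact hg _ (hgn _)

theorem eq_of_mem_iter {K : Set ℂ} {u : ℤ → ℂ} (hu : ∀ n, u (n + 1) ∈ T K (u n)) {n : ℕ} {z : ℂ}
    (hz : z ∈ iter K n (u 0)) : z = u n := by
  induction n generalizing z with
  | zero => simpa [iter] using hz
  | succ n ih =>
    obtain ⟨y, hy, hz⟩ := Part.mem_bind_iff.1 hz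
    rw [ih hy] at hz
    exact Part.mem_unique hz (by exact_mod_cast hu n)

/-- Injectivity of `T` propagates the coincidence of `u N` and `u 0` backwards, so a periodic orbit
has only finitely many past points. -/
theorem apply_sub_of_apply_eq {K : Set ℂ} {u : ℤ → ℂ} (hu : ∀ n, u (n + 1) ∈ T K (u n)) {N : ℕ}
    (hN : u N = u 0) (m : ℕ) : u (-(m : ℤ)) = u (-((m % N : ℕ) : ℤ)) := by
  have key (m : ℕ) : u (N - m) = u (-m) := by
    induction m with
    | zero => simpa using hN
    | succ m ih =>
      have h1 := hu (N - (m + 1 : ℕ))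
      have h2 := hu (-(m + 1 : ℕ))
      rw [show (N : ℤ) - (m + 1 : ℕ) + 1 = N - m by push_cast; ring, ih] at h1
      rw [show -((m + 1 : ℕ) : ℤ) + 1 = -m by push_cast; ring] at h2
      exact T_injective h1 h2
  have key' (r i : ℕ) : u (-((r + N * i : ℕ) : ℤ)) = u (-(r : ℤ)) := by
    induction i with
    | zero => simp
    | succ i ih => rw [← ih, ← key (r + N * (i + 1))]; congr 1; push_cast; ring
  conv_lhs => rw [← Nat.mod_add_div m N]
  exact key' _ _

/-- A point of the cone whose orbit accumulates at the vertex in the past, and that is renormalized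
in the future as well, is aperiodic. -/
theorem isAperiodicPoint_of_transGen {c w : ℂ} (hw : w ≠ 0) {p q : ℂ} (hp : p ≠ 0)
    (hpast : ∀ n : ℕ, TransGen (Moves coneMoves) ((ratio : ℂ) ^ (n + 1) * p) ((ratio : ℂ) ^ n * p))
    (hpq : TransGen (Moves coneMoves) p q)
    (hfut : ∀ n : ℕ, TransGen (Moves coneMoves) ((ratio : ℂ) ^ n * q) ((ratio : ℂ) ^ (n + 1) * q)) :
    IsAperiodicPoint (regularPolygon 12 c w) (point c w 0 p) := by
  -- `S` consists of the points reachable from some `ratio ^ n * p` that also lead to some `ratio ^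
  -- n * q`; each has a successor and a predecessor in `S`.
  let S : Set ℂ := {z | ∃ k x, z = point c w k x ∧
    (∃ n : ℕ, ReflTransGen (Moves coneMoves) ((ratio : ℂ) ^ n * p) x) ∧
    ∃ n : ℕ, ReflTransGen (Moves coneMoves) x ((ratio : ℂ) ^ n * q)}
  obtain ⟨u, hu0, hu⟩ : ∃ u : ℤ → ℂ, u 0 = point c w 0 p ∧
      ∀ n, u (n + 1) ∈ T (regularPolygon 12 c w) (u n) := by
    refine exists_int_chain (R := fun x y => y ∈ T (regularPolygon 12 c w) x) (S := S) ?_ ?_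
      ⟨0, p, rfl, ⟨0, by simpa using .refl⟩, ⟨0, by simpa using hpq.to_reflTransGen⟩⟩
    · rintro _ ⟨k, x, rfl, ⟨n, hn⟩, ⟨m, hm⟩⟩
      obtain ⟨y, hxy, hy⟩ := TransGen.head'_iff.1 (TransGen.trans_right hm (hfut m))
      obtain ⟨i, hi⟩ := mem_T_of_moves (c := c) hw hxy
      exact ⟨_, ⟨k + i, y, rfl, ⟨n, hn.tail hxy⟩, ⟨_, hy⟩⟩, hi k⟩
    · rintro _ ⟨k, x, rfl, ⟨n, hn⟩, ⟨m, hm⟩⟩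
      obtain ⟨y, hy, hyx⟩ := TransGen.tail'_iff.1 (TransGen.trans_left (hpast n) hn)
      obtain ⟨i, hi⟩ := mem_T_of_moves (c := c) hw hyx
      refine ⟨_, ⟨k + 11 * i, y, rfl, ⟨_, hy⟩, ⟨m, hm.head hyx⟩⟩, ?_⟩
      have := hi (k + 11 * i)
      rwa [show k + 11 * i + i = k + 12 * i by ring, point_add_twelve_mul] at this
  have hback {x y : ℂ} (hxy : ReflTransGen (Moves coneMoves) x y)
      (hy : ∃ m k : ℕ, u (-(m : ℤ)) = point c w k y) :
      ∃ m k : ℕ, u (-(m : ℤ)) = point c w k x := by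
    induction hxy using ReflTransGen.head_induction_on with
    | refl => exact hy
    | head hab _ ih =>
      obtain ⟨m, k, hm⟩ := ih
      obtain ⟨i, hi⟩ := mem_T_of_moves (c := c) hw hab
      refine ⟨m + 1, k + 11 * i, ?_⟩
      have h1 := hi (k + 11 * i)
      rw [show k + 11 * i + i = k + 12 * i by ring, point_add_twelve_mul, ← hm] at h1
      have h2 := hu (-((m + 1 : ℕ) : ℤ))
      rw [show -((m + 1 : ℕ) : ℤ) + 1 = -m by push_cast; ring] at h2
      exact T_injective h2 h1
  have hvisit (n : ℕ) : ∃ m k : ℕ, u (-(m : ℤ)) = point c w k ((ratio : ℂ) ^ n * p) := by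
    induction n with
    | zero => exact ⟨0, 0, by simpa using hu0⟩
    | succ n ih => exact hback (hpast n).to_reflTransGen ih
  refine ⟨?_, ?_, u, hu0, hu⟩
  · obtain ⟨t, ht, -⟩ := mem_T_iff.1 (hu 0)
    rw [← hu0]
    exact ht.1
  · rintro ⟨-, N, hN, hmem⟩
    rw [← hu0] at hmem
    have hper := (eq_of_mem_iter hu hmem).symm
    choose m k hmk using hvisit
    -- Pigeonhole on the time modulo `N` and the vertex modulo 12: two visits coincide, forcing
    -- equal powers of `ratio`.
    obtain ⟨n, n', hne, heq⟩ := Finite.exists_ne_map_eq_of_infinite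
      fun n => ((⟨m n % N, Nat.mod_lt _ hN⟩, ⟨k n % 12, Nat.mod_lt _ (by norm_num)⟩) : Fin N × Fin 12)
    simp only [Prod.mk.injEq, Fin.mk.injEq] at heq
    have e1 := hmk n
    have e2 := hmk n'
    rw [apply_sub_of_apply_eq hu hper, ← point_mod, heq.1, heq.2] at e1
    rw [apply_sub_of_apply_eq hu hper, ← point_mod, e1, point, point] at e2
    have e3 := mul_left_cancel₀ (pow_ne_zero _ zeta_ne_zero) (mul_left_cancel₀ hw (add_left_cancel e2))
    have e4 := mul_right_cancel₀ hp (sub_right_injective e3)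
    have e5 : ratio ^ n = ratio ^ n' := by exact_mod_cast e4
    exact hne (pow_right_injective₀ ratio_pos ratio_lt_one.ne e5)

/-! ### Renormalization -/

theorem transGen_of_cellMoves {x y : ℂ} (h : Moves cellMoves x y) :
    TransGen (Moves coneMoves) x y := by
  obtain ⟨m, hm, hx, rfl⟩ := h
  obtain ⟨c, hc, rfl⟩ := List.mem_map.1 hm
  have h := List.all_eq_true.1 cells_isFirstReturn c hc
  rw [isFirstReturn, Bool.and_eq_true, bne_iff_ne, beq_iff_eq] at h
  simpa using transGen_of_follow hx h.1 (by simp [Isom.one]) h.2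

/-- Self-similarity: the shrunk cell is followed until its composed isometry equals the conjugate of
the cell's isometry. -/
theorem transGen_ratio_mul {x y : ℂ} (h : Moves cellMoves x y) :
    TransGen (Moves cellMoves) (ratio * x) (ratio * y) := by
  obtain ⟨m, hm, hx, rfl⟩ := h
  obtain ⟨c, hc, rfl⟩ := List.mem_map.1 hm
  have h := List.all_eq_true.1 cells_isRenormalizable c hc
  rw [isRenormalizable, Bool.and_eq_true, bne_iff_ne, beq_iff_eq] at h
  simpa [Isom.app_shrink] using
    transGen_of_follow (Region.mem_points_shrink hx) h.1 (by simp [Isom.one]) h.2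

theorem transGen_ratio_pow_mul (n : ℕ) {x y : ℂ} (h : TransGen (Moves cellMoves) x y) :
    TransGen (Moves coneMoves) ((ratio : ℂ) ^ n * x) ((ratio : ℂ) ^ n * y) := by
  -- All shrinking is done for cell moves, which renormalize to cell moves; only afterwards are
  -- these expanded into cone moves.
  have h' : TransGen (Moves cellMoves) ((ratio : ℂ) ^ n * x) ((ratio : ℂ) ^ n * y) := by
    induction n with
    | zero => simpa using h
    | succ n ih =>
      simp only [pow_succ', mul_assoc]
      exact ih.lift' (fun z => (ratio : ℂ) * z) fun _ _ => transGen_ratio_mul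
  exact h'.lift' id fun _ _ => transGen_of_cellMoves

theorem exists_recurrent_point : ∃ p q : ℂ, p ≠ 0 ∧ Moves cellMoves p q ∧
    TransGen (Moves cellMoves) (ratio * p) p ∧ TransGen (Moves cellMoves) q (ratio * q) := by
  have h := cell6_isRecurrent
  simp only [isRecurrent, Bool.and_eq_true, bne_iff_ne, Option.any_eq_true, beq_iff_eq,
    decide_eq_true_eq] at h
  obtain ⟨⟨hm, hn⟩, g, hg, ⟨hmaps, hr⟩, hfut⟩ := h
  obtain ⟨p, hp, hfix⟩ := exists_fixed_point hr hmaps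
  have hp' := Region.mem_points_shrink hp
  refine ⟨p, cell6.isom.app p, ?_, ⟨_, List.mem_map_of_mem (by simp [cells]), hp, rfl⟩, ?_, ?_⟩
  -- The bound of `cell6` in direction 6 is negative, which excludes 0.
  · rintro rfl
    have := hp (6, ⟨-12, 0⟩) (by simp [cell6])
    norm_num [level, Surd.val] at this
  · simpa [hfix] using transGen_of_follow hp' hn (by simp [Isom.one]) hg
  -- Applied to `ratio * p`, the start `c.isom.comp g` gives `q`, and the final `c.isom.shrink`
  -- gives `ratio * q`.
  · have := transGen_of_follow hp' hm (Nat.mod_lt _ (by norm_num)).le hfut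
    rwa [Isom.app_comp, hfix, Isom.app_shrink] at this

end OuterBilliard.Dodecagon

theorem mainTheorem1 (c w : ℂ) (hw : w ≠ 0) :
    ∃ p : ℂ, OuterBilliard.IsAperiodicPoint (OuterBilliard.regularPolygon 12 c w) p := by
  open OuterBilliard.Dodecagon in
  obtain ⟨p, q, hp, hpq, hpast, hfut⟩ := exists_recurrent_point
  refine ⟨_, isAperiodicPoint_of_transGen hw hp (fun n => ?_) (q := q) ?_ fun n => ?_⟩
  · simpa only [pow_succ, mul_assoc] using transGen_ratio_pow_mul n hpast
  · simpa using transGen_ratio_pow_mul 0 (.single hpq)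
  · simpa only [pow_succ, mul_assoc] using transGen_ratio_pow_mul n hfut
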